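/- An overpartition of a nonnegative integer $n$ is a partition of $n$ in which the first occurrence of each distinct part size may be overlined. Let $\mathrm{nov}(n)$ (respectively $\mathrm{ov}(n)$) denote the sum, over all overpartitions of $n$, of the non-overlined (respectively overlined) parts. Then for every integer $n \ge 0$, $$(n+2)\,\mathrm{nov}(n) \equiv (n^2+4n+3)\,\mathrm{ov}(n) \pmod 5$$ and $$(n^2+1)\,\mathrm{nov}(n) \equiv (4n^3-n^2-1)\,\mathrm{ov}(n) \pmod 7.$$ -/

import Mathlib

/-- An overpartition of `n`: a partition of `n` in which the first occurrence of each distinct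
part size may be overlined. It is given by the underlying partition and the set of those part
sizes whose first occurrence is overlined. -/
@[ext]
structure Overpartition (n : ℕ) where
  /-- the underlying partition, with the overlines forgotten -/
  partition : n.Partition
  /-- the sizes whose first occurrence is overlined -/
  marked : Finset ℕ
  /-- only sizes that occur in the partition can be overlined -/
  marked_subset : marked ⊆ partition.parts.toFinset

namespace Overpartition

/-- An overpartition is the same as a partition together with a subset of its part sizes. -/
def equivSigma (n : ℕ) :
    (Σ p : n.Partition, {s : Finset ℕ // s ∈ p.parts.toFinset.powerset}) ≃ Overpartition n where
  toFun x := ⟨x.1, x.2.1, Finset.mem_powerset.mp x.2.2⟩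
  invFun o := ⟨o.partition, o.marked, Finset.mem_powerset.mpr o.marked_subset⟩
  left_inv _ := rfl
  right_inv _ := rfl

instance (n : ℕ) : Fintype (Overpartition n) := Fintype.ofEquiv _ (equivSigma n)

/-- The multiset of overlined parts: each overlined size occurs exactly once as overlined part. -/
def overlinedParts {n : ℕ} (o : Overpartition n) : Multiset ℕ := o.marked.val

/-- The multiset of non-overlined parts: all parts, with one occurrence of each overlined size
removed. -/
def nonOverlinedParts {n : ℕ} (o : Overpartition n) : Multiset ℕ :=
  o.partition.parts - o.marked.val

end Overpartition

/-- `ov n` is the sum, over all overpartitions of `n`, of the overlined parts. -/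
def ov (n : ℕ) : ℕ := ∑ o : Overpartition n, o.overlinedParts.sum

/-- `nov n` is the sum, over all overpartitions of `n`, of the non-overlined parts. -/
def nov (n : ℕ) : ℕ := ∑ o : Overpartition n, o.nonOverlinedParts.sum

/-! Write `D` for `X · d/dX`, `φ = φ(X)`, `φ₋ = φ(-X)`, and `P` for the generating function of the
number of overpartitions. Since `nov n + ov n` is `n` times that number, each congruence is a linear
relation between `D`-derivatives of `P` and of the series of `ov`.

Gauss's identity gives `P = 1/φ₋`, and counting by overlined size gives the series of `ov` as `P · ∑
k X^k / (1 + X^k)`. The last sum is an Eisenstein series: `1 + 24 ∑ k X^k / (1 + X^k) = 2 φ^4 -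
φ₋^4` (`one_add_lambert_eq`). As 24 is invertible modulo 5 and 7, everything is expressed by `P`, `y
= φ^4` and `z = φ₋^4`.

With `w = D φ₋ / φ₋` the system closes under `D`: `D P = -P w`, `D z = 4wz`, `D y = 4wy + y(y - z)`
(`four_mul_eulerLog_phi_sub`) and `8 D w = 16 w^2 - y(y - z)` (`eight_mul_euler_eulerLog_phiNeg`
with the factor `y` from `φ^4`). So each relation is `P` times a polynomial in `w, y, z`. What makes
it vanish modulo `p` is one further relation: the exponents of `φ₋` are squares `a^2`, and `a^(p+1)
= a^2` modulo `p`, so `D^((p+1)/2) φ₋ = D φ₋` (`iterate_euler_thetaSeries`).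

The theta identities come from rotating the square lattice, followed by uniqueness for functional
equations under `X ↦ X^2`; no modular forms are needed. -/

open PowerSeries

/-! ### The Euler operator and the substitution `X ↦ X ^ 2` -/

section Euler
variable {R : Type*} [CommRing R]

/-- The Euler operator `X · d/dX` on power series. -/
noncomputable def euler (R : Type*) [CommRing R] : Derivation R R⟦X⟧ R⟦X⟧ :=
  (X : R⟦X⟧) • PowerSeries.derivative R

lemma coeff_euler (h : R⟦X⟧) (n : ℕ) : coeff n (euler R h) = n * coeff n h := by
  change coeff n (X * PowerSeries.derivative R h) = _
  cases n with
  | zero => simp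
  | succ n => rw [mul_comm, coeff_succ_mul_X, coeff_derivative]; push_cast; ring

/-- The substitution `X ↦ X ^ 2`. -/
noncomputable def expandTwo (R : Type*) [CommRing R] : R⟦X⟧ →ₐ[R] R⟦X⟧ :=
  expand 2 two_ne_zero

lemma coeff_expandTwo_two_mul (h : R⟦X⟧) (n : ℕ) :
    coeff (2 * n) (expandTwo R h) = coeff n h := by
  rw [expandTwo]
  exact coeff_expand_mul (R := R) 2 two_ne_zero h n

lemma coeff_expandTwo_two_mul_add_one (h : R⟦X⟧) (n : ℕ) :
    coeff (2 * n + 1) (expandTwo R h) = 0 :=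
  coeff_expand_of_not_dvd 2 two_ne_zero _ (by omega)

lemma euler_expandTwo (h : R⟦X⟧) :
    euler R (expandTwo R h) = 2 * expandTwo R (euler R h) := by
  ext n
  rw [coeff_euler, two_mul, map_add]
  obtain ⟨k, rfl | rfl⟩ := n.even_or_odd'
  · simp only [coeff_expandTwo_two_mul, coeff_euler]; push_cast; ring
  · simp [coeff_expandTwo_two_mul_add_one]

/-- A power series fixed by `X ↦ X ^ 2` up to a scalar vanishes if its constant term does. -/
lemma eq_zero_of_eq_mul_expandTwo {c : R} {h : R⟦X⟧} (h0 : coeff 0 h = 0)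
    (hc : h = C c * expandTwo R h) : h = 0 := by
  ext n
  induction n using Nat.strong_induction_on with
  | _ n ih =>
    rw [hc, coeff_C_mul, map_zero]
    obtain ⟨k, rfl | rfl⟩ := n.even_or_odd'
    · rw [coeff_expandTwo_two_mul]
      rcases Nat.eq_zero_or_pos k with rfl | hk
      · simp [h0]
      · simp [ih k (by omega)]
    · simp [coeff_expandTwo_two_mul_add_one]
end Euler

/-! ### Quadratic theta identities from lattice points on circles -/

section Theta
variable {R : Type*} [CommRing R]

/-- The theta series `∑ j : ℤ, s j X ^ (j ^ 2)`. -/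
noncomputable def thetaSeries (s : ℤ → R) : R⟦X⟧ :=
  mk fun n => ∑ j ∈ (Finset.Icc (-(n : ℤ)) n).filter (fun j => j ^ 2 = (n : ℤ)), s j

/-- The lattice points on the circle of squared radius `n`. -/
noncomputable def circlePoints (n : ℕ) : Finset (ℤ × ℤ) :=
  (Finset.Icc (-(n : ℤ)) n ×ˢ Finset.Icc (-(n : ℤ)) n).filter
    (fun p => p.1 ^ 2 + p.2 ^ 2 = (n : ℤ))

lemma mem_Icc_of_sq_le {j : ℤ} {n : ℕ} (h : j ^ 2 ≤ n) : -(n : ℤ) ≤ j ∧ j ≤ n := by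
  constructor <;> nlinarith [sq_nonneg j, sq_nonneg (j - 1), sq_nonneg (j + 1)]

lemma mem_circlePoints {n : ℕ} {p : ℤ × ℤ} :
    p ∈ circlePoints n ↔ p.1 ^ 2 + p.2 ^ 2 = (n : ℤ) := by
  simp only [circlePoints, Finset.mem_filter, Finset.mem_product, Finset.mem_Icc,
    and_iff_right_iff_imp]
  intro h
  exact ⟨mem_Icc_of_sq_le (by nlinarith [sq_nonneg p.2]),
    mem_Icc_of_sq_le (by nlinarith [sq_nonneg p.1])⟩

lemma coeff_thetaSeries_mul (s t : ℤ → R) (n : ℕ) :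
    coeff n (thetaSeries s * thetaSeries t) = ∑ p ∈ circlePoints n, s p.1 * t p.2 := by
  rw [coeff_mul, ← Finset.sum_fiberwise_of_maps_to
    (g := fun p : ℤ × ℤ => ((p.1 ^ 2).toNat, (p.2 ^ 2).toNat)) (t := Finset.HasAntidiagonal.antidiagonal n)]
  · refine Finset.sum_congr rfl fun x hx => ?_
    simp only [thetaSeries, coeff_mk]
    rw [Finset.sum_mul_sum, ← Finset.sum_product']
    refine Finset.sum_congr ?_ fun _ _ => rfl
    ext p
    have := Finset.HasAntidiagonal.mem_antidiagonal.mp hx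
    simp only [Finset.mem_product, Finset.mem_filter, Finset.mem_Icc, mem_circlePoints,
      Prod.ext_iff]
    have h1 := sq_nonneg p.1
    have h2 := sq_nonneg p.2
    constructor
    · rintro ⟨⟨_, h⟩, ⟨_, h'⟩⟩
      omega
    · rintro ⟨h, h', h''⟩
      have e1 : p.1 ^ 2 = x.1 := by omega
      have e2 : p.2 ^ 2 = x.2 := by omega
      exact ⟨⟨mem_Icc_of_sq_le e1.le, e1⟩, ⟨mem_Icc_of_sq_le e2.le, e2⟩⟩
  · intro p hp
    rw [mem_circlePoints] at hp
    have h1 := sq_nonneg p.1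
    have h2 := sq_nonneg p.2
    rw [Finset.HasAntidiagonal.mem_antidiagonal]
    dsimp only
    omega

/-- The rotation `(x, y) ↦ (x + y, x - y)` maps a circle to the points of even coordinate sum
of the circle of twice the squared radius. -/
lemma sum_circlePoints_two_mul (m : ℕ) (F : ℤ × ℤ → R)
    (hF : ∀ p : ℤ × ℤ, Odd (p.1 + p.2) → F p = 0) :
    ∑ p ∈ circlePoints (2 * m), F p = ∑ p ∈ circlePoints m, F (p.1 + p.2, p.1 - p.2) := by
  symm
  refine Finset.sum_of_injOn (fun p => (p.1 + p.2, p.1 - p.2)) ?_ ?_ ?_ fun _ _ => rfl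
  · rintro ⟨a, b⟩ _ ⟨c, d⟩ _ h
    simp only [Prod.mk.injEq] at h ⊢
    omega
  · intro p hp
    simp only [Finset.mem_coe, mem_circlePoints] at hp ⊢
    push_cast
    linear_combination 2 * hp
  · rintro ⟨a, b⟩ hp hp'
    apply hF
    rw [← Int.not_even_iff_odd]
    rintro ⟨c, hc⟩
    apply hp'
    refine ⟨(c, c - b), ?_, ?_⟩
    · simp only [Finset.mem_coe, mem_circlePoints] at hp ⊢
      obtain rfl : a = c + c - b := by simp only at hc; omega
      push_cast at hp
      linarith
    · simp only [Prod.mk.injEq] at hc ⊢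
      omega

lemma odd_sum_of_mem_circlePoints {n : ℕ} (hn : Odd n) {p : ℤ × ℤ} (hp : p ∈ circlePoints n) :
    Odd (p.1 + p.2) := by
  rw [mem_circlePoints] at hp
  have : Odd (p.1 ^ 2 + p.2 ^ 2) := by rw [hp]; exact_mod_cast hn
  simpa [Int.odd_add, Int.odd_pow, Int.even_pow] using this

lemma even_sum_of_mem_circlePoints {m : ℕ} {p : ℤ × ℤ} (hp : p ∈ circlePoints (2 * m)) :
    Even (p.1 + p.2) := by
  rw [mem_circlePoints] at hp
  have : Even (p.1 ^ 2 + p.2 ^ 2) := by rw [hp]; push_cast; exact even_two_mul _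
  simpa [Int.even_add, Int.even_pow] using this

/-- `φ(X) = ∑ X ^ (j ^ 2)`. -/
noncomputable def phi (R : Type*) [CommRing R] : R⟦X⟧ := thetaSeries fun _ => 1

/-- `φ(-X) = ∑ (-1) ^ j X ^ (j ^ 2)`. -/
noncomputable def phiNeg (R : Type*) [CommRing R] : R⟦X⟧ :=
  thetaSeries fun j => ((j.negOnePow : ℤ) : R)

/-- At an even exponent the sign `(-1) ^ (x + y)` is 1 and the rotation matches the two circles; at
an odd exponent every sign is -1 and cancels the count. -/
lemma two_mul_expandTwo_phi_sq :
    2 * expandTwo R (phi R) ^ 2 = phiNeg R ^ 2 + phi R ^ 2 := by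
  rw [← map_pow, phi, phiNeg, sq, sq (thetaSeries _)]
  ext n
  rw [two_mul, map_add, map_add, coeff_thetaSeries_mul, coeff_thetaSeries_mul,
    ← Finset.sum_add_distrib]
  have key (p : ℤ × ℤ) : ((p.1.negOnePow : ℤ) : R) * ((p.2.negOnePow : ℤ) : R) =
      (((p.1 + p.2).negOnePow : ℤ) : R) := by
    rw [Int.negOnePow_add]; push_cast; rfl
  simp only [key]
  obtain ⟨m, rfl | rfl⟩ := n.even_or_odd'
  · rw [coeff_expandTwo_two_mul, coeff_thetaSeries_mul, sum_circlePoints_two_mul,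
      ← Finset.sum_add_distrib]
    · refine Finset.sum_congr rfl fun p _ => ?_
      rw [Int.negOnePow_even _ (by simp)]; simp
    · intro p hp
      rw [Int.negOnePow_odd _ hp]; simp
  · rw [coeff_expandTwo_two_mul_add_one, add_zero]
    refine (Finset.sum_eq_zero fun p hp => ?_).symm
    rw [Int.negOnePow_odd _ (odd_sum_of_mem_circlePoints (by simp) hp)]; simp

lemma sum_circlePoints_swap (n : ℕ) (F : ℤ × ℤ → R) :
    ∑ p ∈ circlePoints n, F p.swap = ∑ p ∈ circlePoints n, F p :=
  Finset.sum_nbij' Prod.swap Prod.swap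
    (fun p hp => by rw [mem_circlePoints] at hp ⊢; simpa [add_comm] using hp)
    (fun p hp => by rw [mem_circlePoints] at hp ⊢; simpa [add_comm] using hp)
    (by simp) (by simp) (by simp)

/-- At even exponents the rotation turns `(-1) ^ (x + y)` into the sign of the first coordinate. At
odd exponents exactly one coordinate is odd, so the two coordinate signs cancel; by the swap
symmetry twice the coefficient is 0. -/
lemma expandTwo_phiNeg_sq {K : Type*} [Field K] (h2 : (2 : K) ≠ 0) :
    expandTwo K (phiNeg K) ^ 2 = phiNeg K * phi K := by
  rw [← map_pow, phi, phiNeg, sq]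
  ext n
  rw [coeff_thetaSeries_mul]
  simp only [mul_one]
  obtain ⟨m, rfl | rfl⟩ := n.even_or_odd'
  · rw [coeff_expandTwo_two_mul, coeff_thetaSeries_mul]
    have h : ∑ p ∈ circlePoints (2 * m), ((p.1.negOnePow : ℤ) : K) =
        ∑ p ∈ circlePoints (2 * m), if Even (p.1 + p.2) then ((p.1.negOnePow : ℤ) : K) else 0 :=
      Finset.sum_congr rfl fun p hp => (if_pos (even_sum_of_mem_circlePoints hp)).symm
    rw [h, sum_circlePoints_two_mul]
    · refine Finset.sum_congr rfl fun p _ => ?_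
      rw [if_pos (by simp), Int.negOnePow_add]; push_cast; rfl
    · intro p hp
      rw [if_neg (by simpa using hp)]
  · rw [coeff_expandTwo_two_mul_add_one]
    have h := sum_circlePoints_swap (2 * m + 1) fun p => ((p.1.negOnePow : ℤ) : K)
    have h' : ∑ p ∈ circlePoints (2 * m + 1), (((p.2.negOnePow : ℤ) : K) +
        ((p.1.negOnePow : ℤ) : K)) = 0 := by
      refine Finset.sum_eq_zero fun p hp => ?_
      have := odd_sum_of_mem_circlePoints (by simp) hp
      rcases Int.even_or_odd p.1 with h1 | h1
      · have h3 : Odd p.2 := by rw [Int.odd_add'] at this; exact this.mpr h1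
        rw [Int.negOnePow_even _ h1, Int.negOnePow_odd _ h3]; simp
      · have h3 : Even p.2 := by simpa [Int.odd_add, h1] using this
        rw [Int.negOnePow_odd _ h1, Int.negOnePow_even _ h3]; simp
    rw [Finset.sum_add_distrib] at h'
    simp only [Prod.fst_swap] at h
    rw [h, ← two_mul] at h'
    exact ((mul_eq_zero.mp h').resolve_left h2).symm
end Theta

/-! ### Differential equations for the theta series -/

section ThetaSystem
variable {K : Type*} [Field K]

/-- The logarithmic derivative with respect to the Euler operator. -/
noncomputable def eulerLog (h : K⟦X⟧) : K⟦X⟧ := h⁻¹ * euler K h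

lemma euler_eq_mul_eulerLog {h : K⟦X⟧} (h0 : constantCoeff h ≠ 0) :
    euler K h = h * eulerLog h := by
  rw [eulerLog, ← mul_assoc, PowerSeries.mul_inv_cancel h h0, one_mul]

lemma constantCoeff_euler (h : K⟦X⟧) : constantCoeff (euler K h) = 0 := by
  rw [← coeff_zero_eq_constantCoeff_apply, coeff_euler]; simp

lemma constantCoeff_eulerLog (h : K⟦X⟧) : constantCoeff (eulerLog h) = 0 := by
  rw [eulerLog, map_mul, constantCoeff_euler, mul_zero]

lemma constantCoeff_thetaSeries (s : ℤ → K) : constantCoeff (thetaSeries s) = s 0 := by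
  rw [← coeff_zero_eq_constantCoeff_apply, thetaSeries, coeff_mk]
  simp [Finset.filter_singleton]

lemma coeff_one_thetaSeries (s : ℤ → K) : coeff 1 (thetaSeries s) = s (-1) + s 1 := by
  have : (Finset.Icc (-((1 : ℕ) : ℤ)) ((1 : ℕ) : ℤ)).filter (fun j => j ^ 2 = ((1 : ℕ) : ℤ)) =
      {-1, 1} := by
    ext j
    simp only [Finset.mem_filter, Finset.mem_Icc, Nat.cast_one, Finset.mem_insert, Finset.mem_singleton, sq_eq_one_iff]
    omega
  rw [thetaSeries, coeff_mk, this, Finset.sum_pair (by norm_num)]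

lemma constantCoeff_phi : constantCoeff (phi K) = 1 := constantCoeff_thetaSeries _

lemma constantCoeff_phiNeg : constantCoeff (phiNeg K) = 1 := by
  simp [phiNeg, constantCoeff_thetaSeries]

lemma coeff_one_phi : coeff 1 (phi K) = 2 := by
  rw [phi, coeff_one_thetaSeries]; norm_num

lemma coeff_one_phiNeg : coeff 1 (phiNeg K) = -2 := by
  rw [phiNeg, coeff_one_thetaSeries, Int.negOnePow_odd _ (by decide),
    Int.negOnePow_odd _ (by decide)]
  norm_num

lemma euler_phi : euler K (phi K) = phi K * eulerLog (phi K) :=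
  euler_eq_mul_eulerLog (by simp [constantCoeff_phi])

lemma euler_phiNeg : euler K (phiNeg K) = phiNeg K * eulerLog (phiNeg K) :=
  euler_eq_mul_eulerLog (by simp [constantCoeff_phiNeg])

lemma coeff_one_eulerLog {h : K⟦X⟧} (h0 : constantCoeff h = 1) :
    coeff 1 (eulerLog h) = coeff 1 h := by
  have := congrArg (coeff 1) (euler_eq_mul_eulerLog (h := h) (by simp [h0]))
  rw [coeff_euler, coeff_one_mul, constantCoeff_eulerLog, h0] at this
  simpa using this.symm

lemma phi_ne_zero : phi K ≠ 0 := fun h => by simpa [h] using constantCoeff_phi (K := K)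

lemma phiNeg_ne_zero : phiNeg K ≠ 0 := fun h => by simpa [h] using constantCoeff_phiNeg (K := K)

lemma euler_mul (a b : K⟦X⟧) : euler K (a * b) = a * euler K b + b * euler K a := by
  simp

lemma euler_sq (a : K⟦X⟧) : euler K (a ^ 2) = 2 * a * euler K a := by
  rw [sq, euler_mul]; ring

lemma euler_pow_four (a : K⟦X⟧) : euler K (a ^ 4) = 4 * a ^ 3 * euler K a := by
  rw [show a ^ 4 = (a ^ 2) ^ 2 by ring, euler_sq, euler_sq]; ring

lemma euler_ofNat (n : ℕ) [n.AtLeastTwo] (a : K⟦X⟧) :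
    euler K (OfNat.ofNat n * a) = OfNat.ofNat n * euler K a := by
  rw [euler_mul, show (OfNat.ofNat n : K⟦X⟧) = (n : ℕ) from rfl, Derivation.map_natCast, mul_zero,
    add_zero]

lemma four_mul_expandTwo_eulerLog_phiNeg (h2 : (2 : K) ≠ 0) :
    4 * expandTwo K (eulerLog (phiNeg K)) = eulerLog (phiNeg K) + eulerLog (phi K) := by
  have h := expandTwo_phiNeg_sq h2
  have hD := congrArg (euler K) h
  rw [euler_sq, euler_expandTwo, euler_mul, euler_phi, euler_phiNeg, map_mul] at hD
  refine mul_left_cancel₀ (mul_ne_zero (phiNeg_ne_zero (K := K)) phi_ne_zero) ?_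
  linear_combination hD - 4 * expandTwo K (eulerLog (phiNeg K)) * h

lemma expandTwo_eulerLog_phi :
    4 * (phiNeg K ^ 2 + phi K ^ 2) * expandTwo K (eulerLog (phi K)) =
      2 * (phiNeg K ^ 2 * eulerLog (phiNeg K) + phi K ^ 2 * eulerLog (phi K)) := by
  have h := two_mul_expandTwo_phi_sq (R := K)
  have hD := congrArg (euler K) h
  rw [euler_ofNat, euler_sq, euler_expandTwo, map_add, euler_sq, euler_sq, euler_phi,
    euler_phiNeg, map_mul] at hD
  linear_combination hD - 4 * expandTwo K (eulerLog (phi K)) * h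

lemma two_ne_zero_powerSeries (h2 : (2 : K) ≠ 0) : (2 : K⟦X⟧) ≠ 0 := fun h =>
  h2 (by simpa only [map_ofNat, map_zero] using congrArg (constantCoeff (R := K)) h)

lemma four_mul_expandTwo_phi_pow_four :
    4 * expandTwo K (phi K) ^ 4 = (phiNeg K ^ 2 + phi K ^ 2) ^ 2 := by
  rw [← two_mul_expandTwo_phi_sq]; ring

lemma expandTwo_phiNeg_pow_four (h2 : (2 : K) ≠ 0) :
    expandTwo K (phiNeg K) ^ 4 = phiNeg K ^ 2 * phi K ^ 2 := by
  rw [show expandTwo K (phiNeg K) ^ 4 = (expandTwo K (phiNeg K) ^ 2) ^ 2 by ring,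
    expandTwo_phiNeg_sq h2]; ring

lemma order_phiNeg_sq_add_phi_sq (h2 : (2 : K) ≠ 0) :
    (4 * (phiNeg K ^ 2 + phi K ^ 2)).order = 0 := by
  have h : constantCoeff (4 * (phiNeg K ^ 2 + phi K ^ 2)) = (2 : K) ^ 3 := by
    simp only [map_mul, map_add, map_pow, constantCoeff_phi, constantCoeff_phiNeg, map_ofNat]
    norm_num
  rw [order_zero_of_unit]
  rw [isUnit_iff_constantCoeff, h]
  exact (pow_ne_zero 3 h2).isUnit

lemma order_phi_sq_sub_phiNeg_sq (h2 : (2 : K) ≠ 0) :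
    (phi K ^ 2 - phiNeg K ^ 2).order = 1 := by
  refine order_eq_nat.mpr ⟨?_, fun i hi => ?_⟩
  · rw [map_sub, coeff_one_pow, coeff_one_pow, constantCoeff_phi, constantCoeff_phiNeg,
      coeff_one_phi, coeff_one_phiNeg]
    have := pow_ne_zero 3 h2
    norm_num at this ⊢
    exact this
  · obtain rfl : i = 0 := by omega
    simp [constantCoeff_phi, constantCoeff_phiNeg]

/-- Jacobi's relation between the logarithmic derivatives of `φ(±X)` and their fourth powers. -/
theorem four_mul_eulerLog_phi_sub (h2 : (2 : K) ≠ 0) :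
    4 * (eulerLog (phi K) - eulerLog (phiNeg K)) = phi K ^ 4 - phiNeg K ^ 4 := by
  set Δ := 4 * (eulerLog (phi K) - eulerLog (phiNeg K)) - (phi K ^ 4 - phiNeg K ^ 4) with hΔ
  -- The logarithmic derivatives of the two quadratic identities show how `Δ` changes under `X ↦ X ^
  -- 2`.
  have hE : 4 * (phiNeg K ^ 2 + phi K ^ 2) * expandTwo K Δ =
      (phi K ^ 2 - phiNeg K ^ 2) * Δ := by
    have e1 := four_mul_expandTwo_eulerLog_phiNeg h2
    have e2 := expandTwo_eulerLog_phi (K := K)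
    have e3 := four_mul_expandTwo_phi_pow_four (K := K)
    have e4 := expandTwo_phiNeg_pow_four h2
    rw [hΔ]
    simp only [map_sub, map_mul, map_pow, map_ofNat]
    linear_combination 4 * e2 - 4 * (phiNeg K ^ 2 + phi K ^ 2) * e1 -
      (phiNeg K ^ 2 + phi K ^ 2) * e3 + 4 * (phiNeg K ^ 2 + phi K ^ 2) * e4
  have c0 : coeff 0 Δ = 0 := by
    simp [hΔ, constantCoeff_phi, constantCoeff_phiNeg, constantCoeff_eulerLog]
  have c1 : coeff 1 Δ = 0 := by
    rw [hΔ, map_sub, map_sub, coeff_one_mul, coeff_one_pow, coeff_one_pow, map_sub, map_sub,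
      coeff_one_eulerLog constantCoeff_phi, coeff_one_eulerLog constantCoeff_phiNeg,
      constantCoeff_eulerLog, constantCoeff_eulerLog, constantCoeff_phi, constantCoeff_phiNeg,
      coeff_one_phi, coeff_one_phiNeg, ← map_ofNat (C (R := K)), constantCoeff_C]
    norm_num
  have hz : Δ = 0 := by
    -- Comparing orders in `hE` gives `2 ord Δ = 1 + ord Δ`, so `ord Δ = 1`, against `c0` and `c1`.
    by_contra hne
    have ho := congrArg order hE
    rw [order_mul, order_mul (phi K ^ 2 - _), order_phiNeg_sq_add_phi_sq h2, order_phi_sq_sub_phiNeg_sq h2,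
      expandTwo, order_expand, ← coe_toNat_order hne] at ho
    have h2le : 2 ≤ Δ.order.toNat := by
      have := nat_le_order Δ 2 (fun i hi => by interval_cases i <;> assumption)
      rw [← coe_toNat_order hne] at this
      exact_mod_cast this
    rw [zero_add, nsmul_eq_mul] at ho
    norm_cast at ho
    omega
  exact sub_eq_zero.mp hz

/-- The Riccati equation for the logarithmic derivative of `φ(-X)`. -/
theorem eight_mul_euler_eulerLog_phiNeg (h2 : (2 : K) ≠ 0) :
    8 * euler K (eulerLog (phiNeg K)) =
      16 * eulerLog (phiNeg K) ^ 2 - phi K ^ 4 * (phi K ^ 4 - phiNeg K ^ 4) := by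
  set w := eulerLog (phiNeg K) with hw
  set v := eulerLog (phi K) with hv
  have hJ : 4 * (v - w) = phi K ^ 4 - phiNeg K ^ 4 := four_mul_eulerLog_phi_sub h2
  have hJ' := congrArg (euler K) hJ
  rw [euler_ofNat, map_sub, map_sub, euler_pow_four, euler_pow_four, euler_phi, euler_phiNeg,
    ← hw, ← hv] at hJ'
  have e1 : 4 * expandTwo K w = w + v := four_mul_expandTwo_eulerLog_phiNeg h2
  have e1' := congrArg (euler K) e1
  rw [euler_ofNat, euler_expandTwo, map_add] at e1'
  have e3 := four_mul_expandTwo_phi_pow_four (K := K)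
  have e4 := expandTwo_phiNeg_pow_four h2
  rw [← sub_eq_zero]
  -- The difference `h` of the two sides satisfies `h(X) = 4 h(X^2)`; this is checked after
  -- multiplication by 4 to clear denominators.
  refine eq_zero_of_eq_mul_expandTwo (c := 4) ?_ ?_
  · simp [constantCoeff_phi, constantCoeff_phiNeg, constantCoeff_euler, hw,
      constantCoeff_eulerLog]
  · have h4 := mul_ne_zero (two_ne_zero_powerSeries h2) (two_ne_zero_powerSeries h2)
    refine mul_left_cancel₀ h4 ?_
    rw [show (C (4 : K) : K⟦X⟧) = 4 from map_ofNat C 4]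
    simp only [map_sub, map_mul, map_pow, map_ofNat]
    have e5 : 16 * (expandTwo K (phi K) ^ 4 *
        (expandTwo K (phi K) ^ 4 - expandTwo K (phiNeg K) ^ 4)) =
        (phi K ^ 4 - phiNeg K ^ 4) ^ 2 := by
      rw [e4]
      linear_combination (4 * expandTwo K (phi K) ^ 4 - 4 * (phiNeg K ^ 2 * phi K ^ 2) +
        (phiNeg K ^ 2 + phi K ^ 2) ^ 2) * e3
    linear_combination -16 * e1' + 16 * (4 * expandTwo K w + w + v) * e1 - e5 - 4 * hJ' +
      (-4 * phi K ^ 4 + 4 * (v - w) + (phi K ^ 4 - phiNeg K ^ 4) + 16 * w) * hJ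
end ThetaSystem

/-! ### Gauss's product for `φ(-X)` -/

section Gauss
variable {K : Type*} [Field K]

/-- The partial products of `∏ (1 - X ^ k) / (1 + X ^ k)`. -/
noncomputable def gaussProd (K : Type*) [Field K] (n : ℕ) : K⟦X⟧ :=
  ∏ k ∈ Finset.range n, ((1 - X ^ (k + 1)) * (1 + X ^ (k + 1))⁻¹)

lemma gaussProd_succ (n : ℕ) :
    gaussProd K (n + 1) = gaussProd K n * ((1 - X ^ (n + 1)) * (1 + X ^ (n + 1))⁻¹) :=
  Finset.prod_range_succ _ _

lemma one_add_X_pow_mul_inv (n : ℕ) : (1 + X ^ (n + 1) : K⟦X⟧) * (1 + X ^ (n + 1))⁻¹ = 1 :=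
  PowerSeries.mul_inv_cancel _ (by simp)

lemma one_sub_X_pow_mul_inv (n : ℕ) : (1 - X ^ (n + 1) : K⟦X⟧) * (1 - X ^ (n + 1))⁻¹ = 1 :=
  PowerSeries.mul_inv_cancel _ (by simp)

lemma constantCoeff_gaussProd (n : ℕ) : constantCoeff (gaussProd K n) = 1 := by
  simp [gaussProd, map_prod]

lemma gaussProd_mul_inv (n : ℕ) : gaussProd K n * (gaussProd K n)⁻¹ = 1 :=
  PowerSeries.mul_inv_cancel _ (by simp [constantCoeff_gaussProd])

lemma gaussProd_inv_succ (n : ℕ) : (gaussProd K n)⁻¹ =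
    (gaussProd K (n + 1))⁻¹ * ((1 - X ^ (n + 1)) * (1 + X ^ (n + 1))⁻¹) := by
  have h := gaussProd_mul_inv (K := K) (n + 1)
  rw [gaussProd_succ] at h ⊢
  linear_combination -(gaussProd K n)⁻¹ * h + (gaussProd K n *
    ((1 - X ^ (n + 1)) * (1 + X ^ (n + 1))⁻¹))⁻¹ * ((1 - X ^ (n + 1)) * (1 + X ^ (n + 1))⁻¹) *
    gaussProd_mul_inv (K := K) n

/-- The terms of the finite form of Gauss's identity. -/
noncomputable def gaussTerm (K : Type*) [Field K] (n s : ℕ) : K⟦X⟧ :=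
  (-1) ^ s * (2 * (1 + X ^ s)⁻¹) * gaussProd K n * (gaussProd K s)⁻¹ * X ^ (s * (n + 1))

lemma two_mul_inv_one_add_one (h2 : (2 : K) ≠ 0) : (2 : K⟦X⟧) * (1 + X ^ 0)⁻¹ = 1 := by
  rw [pow_zero, one_add_one_eq_two]
  refine PowerSeries.mul_inv_cancel _ ?_
  rwa [map_ofNat]

lemma gaussTerm_zero (h2 : (2 : K) ≠ 0) (n : ℕ) : gaussTerm K n 0 = gaussProd K n := by
  rw [gaussTerm, two_mul_inv_one_add_one h2]
  simp [gaussProd]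

/-- The closed form for the change from `n` to `n + 1`. At `m = n` it combines with the new term `s
= n + 1`: the factor `1 + X ^ (n + 1)` cancels and exactly the next theta term `2 (-1) ^ (n + 1) X ^
((n + 1) ^ 2)` remains. -/
lemma sum_gaussTerm_sub (h2 : (2 : K) ≠ 0) (n m : ℕ) :
    ∑ s ∈ Finset.range (m + 1), (gaussTerm K (n + 1) s - gaussTerm K n s) =
      -2 * (1 + X ^ (n + 1))⁻¹ * gaussProd K n * (-1) ^ m * (X ^ (n + 1)) ^ (m + 1) *
        (gaussProd K m)⁻¹ := by
  have ha := one_add_X_pow_mul_inv (K := K) n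
  induction m with
  | zero =>
    rw [Finset.sum_range_one, gaussTerm_zero h2, gaussTerm_zero h2, gaussProd_succ]
    have : (gaussProd K 0)⁻¹ = 1 := by simp [gaussProd]
    rw [this]
    linear_combination gaussProd K n * ha
  | succ m ih =>
    rw [Finset.sum_range_succ, ih, gaussTerm, gaussTerm, gaussProd_succ n, gaussProd_inv_succ m,
      show (X : K⟦X⟧) ^ ((m + 1) * (n + 1 + 1)) = (X ^ (n + 1)) ^ (m + 1) * X ^ (m + 1) by ring,
      show (X : K⟦X⟧) ^ ((m + 1) * (n + 1)) = (X ^ (n + 1)) ^ (m + 1) by ring]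
    have hb := one_add_X_pow_mul_inv (K := K) m
    generalize (gaussProd K (m + 1))⁻¹ = P
    generalize gaussProd K n = Q
    generalize (1 + X ^ (n + 1) : K⟦X⟧)⁻¹ = i at *
    generalize (1 + X ^ (m + 1) : K⟦X⟧)⁻¹ = j at *
    generalize (X : K⟦X⟧) ^ (n + 1) = a at *
    generalize (X : K⟦X⟧) ^ (m + 1) = b at *
    linear_combination 2 * (-1) ^ (m + 1) * Q * a ^ (m + 1) * P * (j * ha - a * i * hb)

/-- The partial sums of `∑ (-1) ^ j X ^ (j ^ 2)`. -/
noncomputable def gaussPartialSum (K : Type*) [Field K] (n : ℕ) : K⟦X⟧ :=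
  1 + 2 * ∑ s ∈ Finset.range n, (-1) ^ (s + 1) * X ^ ((s + 1) ^ 2)

/-- The finite form of Gauss's identity. -/
lemma sum_gaussTerm (h2 : (2 : K) ≠ 0) (n : ℕ) :
    ∑ s ∈ Finset.range (n + 1), gaussTerm K n s = gaussPartialSum K n := by
  induction n with
  | zero => simp [gaussTerm_zero h2, gaussProd, gaussPartialSum]
  | succ n ih =>
    have h := sum_gaussTerm_sub h2 n n
    rw [Finset.sum_sub_distrib, ih] at h
    have hS : gaussPartialSum K (n + 1) =
        gaussPartialSum K n + 2 * ((-1) ^ (n + 1) * X ^ ((n + 1) ^ 2)) := by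
      rw [gaussPartialSum, gaussPartialSum, Finset.sum_range_succ]; ring
    have hl : gaussTerm K (n + 1) (n + 1) =
        (-1) ^ (n + 1) * (2 * (1 + X ^ (n + 1))⁻¹) * X ^ ((n + 1) * (n + 1 + 1)) := by
      rw [gaussTerm]
      linear_combination (-1) ^ (n + 1) * (2 * (1 + X ^ (n + 1))⁻¹) *
        X ^ ((n + 1) * (n + 1 + 1)) * gaussProd_mul_inv (K := K) (n + 1)
    rw [Finset.sum_range_succ, hl, hS]
    have e1 : (X : K⟦X⟧) ^ ((n + 1) * (n + 1 + 1)) = X ^ ((n + 1) ^ 2) * X ^ (n + 1) := by ring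
    have e2 : ((X : K⟦X⟧) ^ (n + 1)) ^ (n + 1) = X ^ ((n + 1) ^ 2) := by ring
    rw [e2] at h
    rw [e1]
    linear_combination h - 2 * (1 + X ^ (n + 1))⁻¹ * (-1) ^ n * X ^ ((n + 1) ^ 2) *
      gaussProd_mul_inv (K := K) n +
      2 * (-1) ^ (n + 1) * X ^ ((n + 1) ^ 2) * one_add_X_pow_mul_inv (K := K) n

/-- In the finite identity the term `s = 0` is the product, and every other term carries `X ^ (s *
(n + 1))` with `s ≥ 1`. -/
lemma X_pow_dvd_gaussPartialSum_sub_gaussProd (h2 : (2 : K) ≠ 0) (n : ℕ) :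
    X ^ (n + 1) ∣ gaussPartialSum K n - gaussProd K n := by
  rw [← sum_gaussTerm h2, Finset.sum_range_succ', gaussTerm_zero h2, add_sub_cancel_right]
  refine Finset.dvd_sum fun s _ => Dvd.dvd.mul_left (pow_dvd_pow _ ?_) _
  nlinarith

lemma coeff_gaussPartialSum (n m : ℕ) : coeff m (gaussPartialSum K n) =
    (if m = 0 then 1 else 0) +
      2 * ∑ s ∈ Finset.range n, if m = (s + 1) ^ 2 then (-1) ^ (s + 1) else 0 := by
  rw [gaussPartialSum, ← map_ofNat (C (R := K)), map_add, coeff_one, coeff_C_mul, map_sum]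
  congr 2
  refine Finset.sum_congr rfl fun s _ => ?_
  rw [← map_one (C (R := K)), ← map_neg, ← map_pow, coeff_C_mul, coeff_X_pow]
  simp

lemma X_pow_dvd_gaussPartialSum_sub_phiNeg (n : ℕ) :
    X ^ (n + 1) ∣ gaussPartialSum K n - phiNeg K := by
  rw [X_pow_dvd_iff]
  intro m hm
  rw [map_sub, coeff_gaussPartialSum, sub_eq_zero]
  rcases Nat.eq_zero_or_pos m with rfl | hm0
  · rw [coeff_zero_eq_constantCoeff_apply, constantCoeff_phiNeg, if_pos rfl,
      Finset.sum_eq_zero, mul_zero, add_zero]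
    intro s _
    rw [if_neg (by positivity)]
  rw [if_neg hm0.ne', zero_add, phiNeg, thetaSeries, coeff_mk]
  by_cases hsq : ∃ k, m = (k + 1) ^ 2
  · obtain ⟨k, rfl⟩ := hsq
    rw [Finset.sum_eq_single k]
    · have : (Finset.Icc (-(((k + 1) ^ 2 : ℕ) : ℤ)) ((k + 1) ^ 2 : ℕ)).filter
          (fun j => j ^ 2 = (((k + 1) ^ 2 : ℕ) : ℤ)) = {-((k : ℤ) + 1), (k : ℤ) + 1} := by
        ext j
        simp only [Finset.mem_filter, Finset.mem_Icc, Finset.mem_insert, Finset.mem_singleton]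
        push_cast
        rw [sq_eq_sq_iff_eq_or_eq_neg]
        constructor
        · tauto
        · rintro (rfl | rfl)
          · exact ⟨by constructor <;> nlinarith, Or.inr rfl⟩
          · exact ⟨by constructor <;> nlinarith, Or.inl rfl⟩
      rw [this, Finset.sum_pair (by omega), Int.negOnePow_neg, if_pos rfl, two_mul]
      have e : (((k : ℤ) + 1).negOnePow : ℤ) = (-1) ^ (k + 1) := by
        have := Int.coe_negOnePow_natCast (k + 1)
        simpa using this
      rw [e]
      simp
    · intro s _ hs
      rw [if_neg]
      intro h
      exact hs (by have := Nat.pow_left_injective (n := 2) (by norm_num) h; omega)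
    · intro h
      rw [Finset.mem_range] at h
      nlinarith
  · rw [Finset.sum_eq_zero, mul_zero, Finset.sum_eq_zero]
    · intro j hj
      rw [Finset.mem_filter] at hj
      refine absurd ⟨j.natAbs - 1, ?_⟩ hsq
      have h0 : j ≠ 0 := by
        rintro rfl
        have := hj.2
        norm_num at this
        omega
      have : j.natAbs - 1 + 1 = j.natAbs := by have := Int.natAbs_pos.mpr h0; omega
      rw [this]
      zify
      rw [sq_abs, hj.2]
    · intro s _
      rw [if_neg fun h => hsq ⟨s, h⟩]

/-- Gauss's identity `φ(-X) = ∏ (1 - X ^ k) / (1 + X ^ k)`, as a statement on truncations. -/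
theorem X_pow_dvd_phiNeg_sub_gaussProd (h2 : (2 : K) ≠ 0) (n : ℕ) :
    X ^ (n + 1) ∣ phiNeg K - gaussProd K n := by
  have := dvd_sub (X_pow_dvd_gaussPartialSum_sub_gaussProd h2 n) (X_pow_dvd_gaussPartialSum_sub_phiNeg n)
  rwa [sub_sub_sub_cancel_left] at this

end Gauss

/-! ### The logarithmic derivative of the product as a Lambert series -/

section Lambert
variable {K : Type*} [Field K]

lemma eq_of_forall_X_pow_dvd_sub {a b : K⟦X⟧} (h : ∀ n : ℕ, X ^ (n + 1) ∣ a - b) : a = b := by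
  ext n
  have := X_pow_dvd_iff.mp (h n) n n.lt_succ_self
  rwa [map_sub, sub_eq_zero] at this

lemma X_pow_dvd_euler {h : K⟦X⟧} {n : ℕ} (hn : X ^ n ∣ h) : X ^ n ∣ euler K h := by
  rw [X_pow_dvd_iff] at hn ⊢
  intro m hm
  rw [coeff_euler, hn m hm, mul_zero]

lemma expandTwo_X : expandTwo K X = X ^ 2 := expand_X 2 two_ne_zero

lemma X_pow_dvd_expandTwo {h : K⟦X⟧} {n : ℕ} (hn : X ^ n ∣ h) : X ^ n ∣ expandTwo K h := by
  obtain ⟨g, rfl⟩ := hn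
  rw [map_mul, map_pow, expandTwo_X, sq, mul_pow, mul_assoc]
  exact dvd_mul_right _ _

/-- The partial sums of the Lambert series `∑ k X ^ k / (1 - X ^ k)`. -/
noncomputable def lambertSum (K : Type*) [Field K] (n : ℕ) : K⟦X⟧ :=
  ∑ k ∈ Finset.range n, ((k + 1 : ℕ) : K⟦X⟧) * X ^ (k + 1) * (1 - X ^ (k + 1))⁻¹

/-- The Lambert series `∑ k X ^ k / (1 - X ^ k)`. -/
noncomputable def lambert (K : Type*) [Field K] : K⟦X⟧ :=
  mk fun n => coeff n (lambertSum K n)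

lemma X_pow_dvd_lambert_sub_lambertSum (n : ℕ) : X ^ (n + 1) ∣ lambert K - lambertSum K n := by
  rw [X_pow_dvd_iff]
  intro m hm
  rw [map_sub, lambert, coeff_mk, sub_eq_zero]
  have hmn : m ≤ n := by omega
  clear hm
  induction n, hmn using Nat.le_induction with
  | base => rfl
  | succ n hn ih =>
    rw [ih, lambertSum, lambertSum, Finset.sum_range_succ, map_add, mul_assoc, mul_left_comm,
      coeff_X_pow_mul', if_neg (by omega), add_zero]

lemma expandTwo_inv_one_sub_X_pow (k : ℕ) :
    (1 - X ^ (k + 1)) * (1 + X ^ (k + 1)) * expandTwo K (1 - X ^ (k + 1))⁻¹ = 1 := by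
  have h := congrArg (expandTwo K) (one_sub_X_pow_mul_inv (K := K) k)
  rw [map_mul, map_sub, map_one, map_pow, expandTwo_X] at h
  linear_combination h

lemma expandTwo_lambertSum (n : ℕ) : expandTwo K (lambertSum K n) =
    ∑ k ∈ Finset.range n, ((k + 1 : ℕ) : K⟦X⟧) * (X ^ (k + 1)) ^ 2 *
      expandTwo K (1 - X ^ (k + 1))⁻¹ := by
  rw [lambertSum, map_sum]
  refine Finset.sum_congr rfl fun k _ => ?_
  rw [map_mul, map_mul, map_natCast, map_pow, expandTwo_X]
  ring

lemma euler_X_pow (k : ℕ) : euler K (X ^ k) = (k : K⟦X⟧) * X ^ k := by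
  ext n
  rw [coeff_euler, ← map_natCast (C (R := K)), coeff_C_mul, coeff_X_pow]
  split_ifs with h <;> simp [h]

/-- The factor with exponent `k` has logarithmic derivative `-2k X^k / (1 - X^(2k))`, and `a/(1 -
a^2) = a/(1 - a) - a^2/(1 - a^2)`. -/
lemma euler_gaussProd (n : ℕ) : euler K (gaussProd K n) =
    gaussProd K n * (2 * expandTwo K (lambertSum K n) - 2 * lambertSum K n) := by
  induction n with
  | zero => simp [gaussProd, lambertSum]
  | succ n ih =>
    have hu : gaussProd K (n + 1) * (1 + X ^ (n + 1)) = gaussProd K n * (1 - X ^ (n + 1)) := by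
      rw [gaussProd_succ]
      linear_combination gaussProd K n * (1 - X ^ (n + 1)) * one_add_X_pow_mul_inv (K := K) n
    have hD := congrArg (euler K) hu
    rw [euler_mul, euler_mul, map_add, map_sub, Derivation.map_one_eq_zero, euler_X_pow, ih] at hD
    have hne : (1 + X ^ (n + 1) : K⟦X⟧) ≠ 0 := left_ne_zero_of_mul_eq_one
      (one_add_X_pow_mul_inv n)
    refine mul_left_cancel₀ hne ?_
    have hs := one_sub_X_pow_mul_inv (K := K) n
    have he := expandTwo_inv_one_sub_X_pow (K := K) n
    have hl : expandTwo K (lambertSum K (n + 1)) = expandTwo K (lambertSum K n) +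
        ((n + 1 : ℕ) : K⟦X⟧) * (X ^ (n + 1)) ^ 2 * expandTwo K (1 - X ^ (n + 1))⁻¹ := by
      rw [expandTwo_lambertSum, expandTwo_lambertSum, Finset.sum_range_succ]
    have hl' : lambertSum K (n + 1) = lambertSum K n +
        ((n + 1 : ℕ) : K⟦X⟧) * X ^ (n + 1) * (1 - X ^ (n + 1))⁻¹ := by
      rw [lambertSum, lambertSum, Finset.sum_range_succ]
    rw [hl, hl']
    generalize (1 - X ^ (n + 1) : K⟦X⟧)⁻¹ = i at *
    generalize gaussProd K (n + 1) = P at *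
    generalize gaussProd K n = Q at *
    generalize ((n + 1 : ℕ) : K⟦X⟧) = c at *
    generalize (X : K⟦X⟧) ^ (n + 1) = a at *
    generalize expandTwo K i = j at *
    have hj : i = (1 + a) * j := by
      linear_combination (1 + a) * j * hs - i * he
    subst hj
    linear_combination hD + (-(2 * expandTwo K (lambertSum K n) - 2 * lambertSum K n) +
      2 * c * a * j - (1 - a) * c * a * j) * hu + c * a * (P + Q) * he

/-- The logarithmic derivative of Gauss's product. -/
theorem eulerLog_phiNeg (h2 : (2 : K) ≠ 0) :
    eulerLog (phiNeg K) = 2 * expandTwo K (lambert K) - 2 * lambert K := by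
  refine eq_of_forall_X_pow_dvd_sub fun n => ?_
  have h1 := X_pow_dvd_phiNeg_sub_gaussProd h2 n
  have h3 := X_pow_dvd_euler h1
  have h4 := X_pow_dvd_lambert_sub_lambertSum (K := K) n
  have h5 := X_pow_dvd_expandTwo h4
  rw [map_sub, euler_gaussProd, euler_phiNeg] at h3
  rw [map_sub] at h5
  obtain ⟨r, hr⟩ := h1
  obtain ⟨r3, hr3⟩ := h3
  obtain ⟨r4, hr4⟩ := h4
  obtain ⟨r5, hr5⟩ := h5
  refine ⟨(gaussProd K n)⁻¹ * (r3 - r * eulerLog (phiNeg K)) + 2 * r4 - 2 * r5, ?_⟩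
  have hi := gaussProd_mul_inv (K := K) n
  linear_combination (gaussProd K n)⁻¹ * hr3 - (gaussProd K n)⁻¹ * eulerLog (phiNeg K) * hr
    + 2 * hr4 - 2 * hr5 - (eulerLog (phiNeg K) -
    2 * expandTwo K (lambertSum K n) + 2 * lambertSum K n) * hi
end Lambert

/-! ### Counting overpartitions by an overlined size -/

namespace Overpartition

lemma pos_of_mem_marked {n k : ℕ} {o : Overpartition n} (h : k ∈ o.marked) : 0 < k :=
  o.partition.parts_pos (Multiset.mem_toFinset.mp (o.marked_subset h))

lemma le_of_mem_marked {n k : ℕ} {o : Overpartition n} (h : k ∈ o.marked) : k ≤ n :=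
  o.partition.le_of_mem_parts (Multiset.mem_toFinset.mp (o.marked_subset h))

/-- Add an overlined part. -/
def addMarked {n k : ℕ} (hk : 0 < k) (o : Overpartition n) : Overpartition (n + k) where
  partition :=
    { parts := k ::ₘ o.partition.parts
      parts_pos := by
        intro i hi
        rcases Multiset.mem_cons.mp hi with rfl | hi
        · exact hk
        · exact o.partition.parts_pos hi
      parts_sum := by rw [Multiset.sum_cons, o.partition.parts_sum, add_comm] }
  marked := insert k o.marked
  marked_subset := by
    rw [Multiset.toFinset_cons]
    exact Finset.insert_subset_insert _ o.marked_subset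

lemma addMarked_injOn {n k : ℕ} (hk : 0 < k) :
    Set.InjOn (addMarked (n := n) hk) {o | k ∉ o.marked} := by
  intro o ho o' ho' h
  have h1 : k ::ₘ o.partition.parts = k ::ₘ o'.partition.parts :=
    congrArg (fun p => p.partition.parts) h
  have h2 : insert k o.marked = insert k o'.marked := congrArg (fun p => p.marked) h
  refine Overpartition.ext (Nat.Partition.ext ((Multiset.cons_inj_right k).mp h1)) ?_
  rw [← Finset.erase_insert ho, h2, Finset.erase_insert ho']

lemma exists_addMarked {n k : ℕ} (hk : 0 < k) (o : Overpartition (n + k)) (ho : k ∈ o.marked) :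
    ∃ o' : Overpartition n, k ∉ o'.marked ∧ addMarked hk o' = o := by
  have hmem : k ∈ o.partition.parts := Multiset.mem_toFinset.mp (o.marked_subset ho)
  refine ⟨⟨⟨o.partition.parts.erase k, fun hi => o.partition.parts_pos (Multiset.mem_of_mem_erase hi),
    ?_⟩, o.marked.erase k, ?_⟩, Finset.notMem_erase _ _, ?_⟩
  · have h1 := Multiset.sum_erase hmem
    have h2 := o.partition.parts_sum
    omega
  · intro i hi
    rw [Finset.mem_erase] at hi
    have h := Multiset.mem_toFinset.mp (o.marked_subset hi.2)
    exact Multiset.mem_toFinset.mpr ((Multiset.mem_erase_of_ne hi.1).mpr h)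
  · refine Overpartition.ext (Nat.Partition.ext ?_) ?_
    · exact Multiset.cons_erase hmem
    · exact Finset.insert_erase ho

/-- The number of overpartitions of `n` in which the part `k` is overlined. -/
def markedCount (k n : ℕ) : ℕ :=
  (Finset.univ.filter fun o : Overpartition n => k ∈ o.marked).card

lemma markedCount_of_lt {k n : ℕ} (h : n < k) : markedCount k n = 0 := by
  rw [markedCount, Finset.card_eq_zero, Finset.filter_eq_empty_iff]
  intro o _ ho
  exact absurd (le_of_mem_marked ho) (by omega)

/-- Deleting the overlined `k` is a bijection onto the overpartitions of `n` in which `k` is not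
overlined; unmarked copies of `k` may remain. -/
lemma markedCount_add {k : ℕ} (hk : 0 < k) (n : ℕ) :
    markedCount k (n + k) + markedCount k n = Fintype.card (Overpartition n) := by
  have : markedCount k (n + k) =
      (Finset.univ.filter fun o : Overpartition n => k ∉ o.marked).card := by
    symm
    refine Finset.card_bij (fun o _ => addMarked hk o) ?_ ?_ ?_
    · intro o _
      simp [addMarked]
    · intro o ho o' ho' h
      exact addMarked_injOn hk (by simpa using ho) (by simpa using ho') h
    · intro o ho
      obtain ⟨o', h1, h2⟩ := exists_addMarked hk o (by simpa using ho)
      exact ⟨o', by simpa using h1, h2⟩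
  rw [this, markedCount, add_comm, Finset.card_filter_add_card_filter_not]
  rfl

lemma ov_eq_sum_markedCount (n : ℕ) :
    ov n = ∑ k ∈ Finset.range n, (k + 1) * markedCount (k + 1) n := by
  have h (o : Overpartition n) : o.overlinedParts.sum =
      ∑ k ∈ Finset.range n, if k + 1 ∈ o.marked then k + 1 else 0 := by
    have hs : o.marked.image (fun k => k - 1) =
        (Finset.range n).filter fun k => k + 1 ∈ o.marked := by
      ext k
      simp only [Finset.mem_image, Finset.mem_filter, Finset.mem_range]
      constructor
      · rintro ⟨j, hj, rfl⟩
        have h1 := pos_of_mem_marked hj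
        have h2 := le_of_mem_marked hj
        rw [Nat.sub_add_cancel h1]
        exact ⟨by omega, hj⟩
      · rintro ⟨_, hk⟩
        exact ⟨k + 1, hk, rfl⟩
    rw [← Finset.sum_filter, ← hs, Finset.sum_image]
    · have : o.overlinedParts.sum = ∑ k ∈ o.marked, k := by
        rw [overlinedParts, Finset.sum_val]; rfl
      rw [this]
      exact Finset.sum_congr rfl fun k hk => (Nat.sub_add_cancel (pos_of_mem_marked hk)).symm
    · intro a ha b hb hab
      have h1 := pos_of_mem_marked ha
      have h2 := pos_of_mem_marked hb
      simp only at hab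
      omega
  simp only [ov, h]
  rw [Finset.sum_comm]
  refine Finset.sum_congr rfl fun k _ => ?_
  rw [← Finset.sum_filter, Finset.sum_const, smul_eq_mul, mul_comm, markedCount]

lemma nov_add_ov (n : ℕ) : nov n + ov n = n * Fintype.card (Overpartition n) := by
  rw [nov, ov, ← Finset.sum_add_distrib, mul_comm, ← smul_eq_mul, ← Finset.card_univ,
    ← Finset.sum_const]
  refine Finset.sum_congr rfl fun o _ => ?_
  have hle : o.marked.val ≤ o.partition.parts :=
    (Multiset.le_iff_subset o.marked.nodup).mpr fun i hi =>
      Multiset.mem_toFinset.mp (o.marked_subset hi)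
  rw [nonOverlinedParts, overlinedParts, ← Multiset.sum_add, Multiset.sub_add_cancel hle,
    o.partition.parts_sum]

lemma card_eq_sum_partition (n : ℕ) : Fintype.card (Overpartition n) =
    ∑ p : n.Partition, p.parts.toFinsupp.prod fun _ _ => 2 := by
  rw [← Fintype.card_congr (equivSigma n), Fintype.card_sigma]
  refine Finset.sum_congr rfl fun p _ => ?_
  rw [Fintype.card_coe, Finset.card_powerset, Finsupp.prod, Finset.prod_const,
    Multiset.toFinsupp_support]

end Overpartition

/-! ### Generating functions of the overpartition counts -/

section GeneratingFunctions
open Overpartition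
variable {K : Type*} [Field K]

/-- The generating function of the number of overpartitions. -/
noncomputable def cardSeries (K : Type*) [Field K] : K⟦X⟧ :=
  mk fun n => (Fintype.card (Overpartition n) : K)

/-- The generating function of `ov`. -/
noncomputable def ovSeries (K : Type*) [Field K] : K⟦X⟧ := mk fun n => (ov n : K)

lemma cardSeries_eq_genFun : cardSeries K = Nat.Partition.genFun fun _ _ => (2 : K) := by
  ext n
  rw [cardSeries, coeff_mk, Nat.Partition.coeff_genFun, card_eq_sum_partition]
  simp [Finsupp.prod]

open scoped PowerSeries.WithPiTopology in
-- A size `k` contributes `1 + 2 ∑ X^(kj)` over `j ≥ 1`, which is `(1 + X^k)/(1 - X^k)`, the inverse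
-- of Gauss's factor. The paired partial products are therefore constantly 1, and the limit is taken
-- coefficientwise.
theorem phiNeg_mul_cardSeries (h2 : (2 : K) ≠ 0) : phiNeg K * cardSeries K = 1 := by
  let _ : TopologicalSpace K := ⊥
  have _ : DiscreteTopology K := ⟨rfl⟩
  have hG := (Nat.Partition.hasProd_genFun fun _ _ => (2 : K)).tendsto_prod_nat
  rw [← cardSeries_eq_genFun] at hG
  have hQ : Filter.Tendsto (gaussProd K) Filter.atTop (nhds (phiNeg K)) := by
    rw [WithPiTopology.tendsto_iff_coeff_tendsto]
    refine fun d => tendsto_atTop_of_eventually_const (i₀ := d) fun n hn => ?_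
    have := X_pow_dvd_iff.mp (X_pow_dvd_phiNeg_sub_gaussProd h2 n) d (by omega)
    rw [map_sub, sub_eq_zero] at this
    exact this.symm
  refine tendsto_nhds_unique (hQ.mul hG) (tendsto_const_nhds.congr fun n => ?_)
  rw [gaussProd, ← Finset.prod_mul_distrib]
  refine (Finset.prod_eq_one fun k _ => ?_).symm
  have h0 : constantCoeff (X ^ (k + 1) : K⟦X⟧) = 0 := by simp
  have hg := WithPiTopology.one_sub_mul_tsum_pow_of_constantCoeff_eq_zero h0
  have hs := WithPiTopology.summable_pow_of_constantCoeff_eq_zero h0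
  rw [hs.tsum_eq_zero_add, pow_zero] at hg
  have hs' := (summable_nat_add_iff 1).mpr hs
  have : ∑' j, (2 : K) • (X : K⟦X⟧) ^ ((k + 1) * (j + 1)) =
      2 * ∑' j, ((X : K⟦X⟧) ^ (k + 1)) ^ (j + 1) := by
    rw [← hs'.tsum_mul_left]
    refine tsum_congr fun j => ?_
    rw [smul_eq_C_mul, map_ofNat, pow_mul]
  rw [this]
  linear_combination 2 * (1 + X ^ (k + 1))⁻¹ * hg + one_add_X_pow_mul_inv (K := K) k

lemma mk_markedCount (k : ℕ) : (mk fun n => (markedCount (k + 1) n : K)) =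
    X ^ (k + 1) * (1 + X ^ (k + 1))⁻¹ * cardSeries K := by
  have h : (1 + X ^ (k + 1)) * (mk fun n => (markedCount (k + 1) n : K)) =
      X ^ (k + 1) * cardSeries K := by
    ext n
    rw [add_mul, one_mul, map_add, coeff_X_pow_mul', coeff_X_pow_mul', coeff_mk]
    split_ifs with hn
    · obtain ⟨m, rfl⟩ := Nat.exists_eq_add_of_le' hn
      rw [Nat.add_sub_cancel, coeff_mk, cardSeries, coeff_mk, ← markedCount_add k.succ_pos]
      push_cast; rfl
    · rw [markedCount_of_lt (by omega)]; simp
  linear_combination (1 + X ^ (k + 1))⁻¹ * h -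
    (mk fun n => (markedCount (k + 1) n : K)) * one_add_X_pow_mul_inv (K := K) k

/-- Termwise this is `a/(1 + a) = a/(1 - a) - 2a^2/(1 - a^2)`. -/
lemma sum_X_pow_mul_inv_one_add (n : ℕ) :
    ∑ k ∈ Finset.range n, ((k + 1 : ℕ) : K⟦X⟧) * X ^ (k + 1) * (1 + X ^ (k + 1))⁻¹ =
      lambertSum K n - 2 * expandTwo K (lambertSum K n) := by
  rw [expandTwo_lambertSum, lambertSum, Finset.mul_sum, ← Finset.sum_sub_distrib]
  refine Finset.sum_congr rfl fun k _ => ?_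
  have hs := one_sub_X_pow_mul_inv (K := K) k
  have ha := one_add_X_pow_mul_inv (K := K) k
  have he := expandTwo_inv_one_sub_X_pow (K := K) k
  generalize (1 - X ^ (k + 1) : K⟦X⟧)⁻¹ = i at *
  generalize (1 + X ^ (k + 1) : K⟦X⟧)⁻¹ = l at *
  generalize expandTwo K i = j at *
  generalize ((k + 1 : ℕ) : K⟦X⟧) = c at *
  generalize (X : K⟦X⟧) ^ (k + 1) = a at *
  obtain rfl : i = (1 + a) * j := by linear_combination (1 + a) * j * hs - i * he
  obtain rfl : l = (1 - a) * j := by linear_combination (1 - a) * j * ha - l * he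
  ring

theorem ovSeries_eq : ovSeries K =
    cardSeries K * (lambert K - 2 * expandTwo K (lambert K)) := by
  ext n
  have h4 := X_pow_dvd_lambert_sub_lambertSum (K := K) n
  have h5 := X_pow_dvd_expandTwo h4
  rw [map_sub] at h5
  have hdvd : X ^ (n + 1) ∣ cardSeries K * (lambert K - 2 * expandTwo K (lambert K)) -
      cardSeries K * (lambertSum K n - 2 * expandTwo K (lambertSum K n)) := by
    rw [← mul_sub, sub_sub_sub_comm, ← mul_sub]
    exact (h4.sub (h5.mul_left 2)).mul_left _
  have hc := X_pow_dvd_iff.mp hdvd n n.lt_succ_self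
  rw [map_sub, sub_eq_zero] at hc
  rw [hc, ← sum_X_pow_mul_inv_one_add, Finset.mul_sum, map_sum, ovSeries, coeff_mk,
    ov_eq_sum_markedCount, Nat.cast_sum]
  refine Finset.sum_congr rfl fun k _ => ?_
  rw [show cardSeries K * (((k + 1 : ℕ) : K⟦X⟧) * X ^ (k + 1) * (1 + X ^ (k + 1))⁻¹) =
    ((k + 1 : ℕ) : K⟦X⟧) * (X ^ (k + 1) * (1 + X ^ (k + 1))⁻¹ * cardSeries K) by ring,
    ← mk_markedCount, ← map_natCast (C (R := K)), coeff_C_mul, coeff_mk, Nat.cast_mul]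
end GeneratingFunctions

/-! ### The Eisenstein series and tools common to both moduli -/

section Congruences
variable {K : Type*} [Field K]

lemma constantCoeff_lambert : constantCoeff (lambert K) = 0 := by
  rw [← coeff_zero_eq_constantCoeff_apply, lambert, coeff_mk, lambertSum, Finset.sum_range_zero,
    map_zero]

lemma constantCoeff_expandTwo (h : K⟦X⟧) : constantCoeff (expandTwo K h) = constantCoeff h :=
  constantCoeff_expand 2 two_ne_zero h

lemma euler_two : euler K 2 = 0 := by exact_mod_cast (euler K).map_natCast 2

lemma euler_four : euler K 4 = 0 := by exact_mod_cast (euler K).map_natCast 4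

lemma euler_five : euler K 5 = 0 := by exact_mod_cast (euler K).map_natCast 5

/-- The Eisenstein series `1 + 24 ∑ k X ^ k / (1 + X ^ k)` in terms of theta series. -/
theorem one_add_lambert_eq (h2 : (2 : K) ≠ 0) :
    1 + 24 * (lambert K - 2 * expandTwo K (lambert K)) = 2 * phi K ^ 4 - phiNeg K ^ 4 := by
  have hJ := four_mul_eulerLog_phi_sub h2
  have e1 := four_mul_expandTwo_eulerLog_phiNeg h2
  have e3 := four_mul_expandTwo_phi_pow_four (K := K)
  have e4 := expandTwo_phiNeg_pow_four h2
  have hw := eulerLog_phiNeg h2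
  have hw' := congrArg (expandTwo K) hw
  simp only [map_sub, map_mul, map_ofNat] at hw'
  rw [← sub_eq_zero]
  -- The difference of the two sides is invariant under `X ↦ X ^ 2` and has no constant term.
  refine eq_zero_of_eq_mul_expandTwo (c := 1) ?_ ?_
  · rw [coeff_zero_eq_constantCoeff_apply]
    simp only [map_sub, map_add, map_mul, map_one, map_pow, constantCoeff_phi,
      constantCoeff_phiNeg, constantCoeff_lambert, constantCoeff_expandTwo]
    rw [← map_ofNat (C (R := K)) 2, constantCoeff_C]
    norm_num
  · refine mul_left_cancel₀ (two_ne_zero_powerSeries h2) ?_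
    rw [map_one]
    simp only [map_add, map_sub, map_mul, map_pow, map_ofNat, map_one]
    linear_combination 24 * hw - 48 * hw' + 12 * e1 + 3 * hJ + e3 - 2 * e4

lemma euler_cardSeries (h2 : (2 : K) ≠ 0) :
    euler K (cardSeries K) = -(cardSeries K * eulerLog (phiNeg K)) := by
  have h := phiNeg_mul_cardSeries h2
  have hD := congrArg (euler K) h
  rw [euler_mul, euler_phiNeg, Derivation.map_one_eq_zero] at hD
  linear_combination cardSeries K * hD - (euler K (cardSeries K) +
    cardSeries K * eulerLog (phiNeg K)) * h

lemma euler_phiNeg_pow_four :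
    euler K (phiNeg K ^ 4) = 4 * (eulerLog (phiNeg K) * phiNeg K ^ 4) := by
  rw [euler_pow_four, euler_phiNeg]; ring

lemma euler_phi_pow_four (h2 : (2 : K) ≠ 0) : euler K (phi K ^ 4) =
    4 * (eulerLog (phiNeg K) * phi K ^ 4) + phi K ^ 4 * (phi K ^ 4 - phiNeg K ^ 4) := by
  rw [euler_pow_four, euler_phi]
  linear_combination phi K ^ 4 * four_mul_eulerLog_phi_sub h2

/-- Only exponents `a ^ 2` occur, and `m` applications of the operator multiply that coefficient by
`a ^ (2m)`. Over `ZMod p` the hypothesis holds for `2m = p + 1` by Fermat. -/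
lemma iterate_euler_thetaSeries (s : ℤ → K) (m : ℕ) (h : ∀ a : ℤ, ((a : K) ^ 2) ^ m = (a : K) ^ 2) :
    (euler K)^[m] (thetaSeries s) = euler K (thetaSeries s) := by
  have hm (m : ℕ) (u : K⟦X⟧) (n : ℕ) :
      coeff n ((euler K)^[m] u) = (n : K) ^ m * coeff n u := by
    induction m generalizing u with
    | zero => simp
    | succ m ih => rw [Function.iterate_succ_apply, ih, coeff_euler]; ring
  ext n
  rw [hm, coeff_euler]
  by_cases hn : ∃ a : ℤ, a ^ 2 = n
  · obtain ⟨a, ha⟩ := hn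
    have : (n : K) = (a : K) ^ 2 := by exact_mod_cast congrArg (Int.cast (R := K)) ha.symm
    rw [this, h]
  · rw [thetaSeries, coeff_mk, Finset.sum_eq_zero, mul_zero, mul_zero]
    intro j hj
    exact absurd ⟨j, (Finset.mem_filter.mp hj).2⟩ hn

lemma coeff_ovSeries (n : ℕ) : coeff n (ovSeries K) = (ov n : K) := coeff_mk _ _

lemma coeff_cardSeries (n : ℕ) :
    coeff n (cardSeries K) = (Fintype.card (Overpartition n) : K) := coeff_mk _ _

lemma natCast_nov (n : ℕ) :
    (nov n : K) = n * (Fintype.card (Overpartition n) : K) - (ov n : K) := by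
  have := congrArg (Nat.cast (R := K)) (Overpartition.nov_add_ov n)
  push_cast at this
  linear_combination this

end Congruences

/-! ### The congruence modulo 5 -/

section ModFive

local instance : Fact (Nat.Prime 5) := ⟨by norm_num⟩

lemma two_ne_zero_zmod_five : (2 : ZMod 5) ≠ 0 := by decide

lemma five_eq_zero : (5 : (ZMod 5)⟦X⟧) = 0 := by
  rw [← map_ofNat (C (R := ZMod 5)), show (OfNat.ofNat 5 : ZMod 5) = 0 from by decide, map_zero]

/-- Substituting `nov n = n c - ov n`, with `c` the number of overpartitions, turns the congruence
into `n^2 ov n = (n^2 + 2n) c`. -/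
theorem euler_sq_ovSeries_five :
    euler (ZMod 5) (euler (ZMod 5) (ovSeries (ZMod 5))) =
      euler (ZMod 5) (euler (ZMod 5) (cardSeries (ZMod 5))) +
        2 * euler (ZMod 5) (cardSeries (ZMod 5)) := by
  have h2 := two_ne_zero_zmod_five
  have h5 := five_eq_zero
  have hP := euler_cardSeries h2
  have hf := euler_phiNeg (K := ZMod 5)
  have hz := euler_phiNeg_pow_four (K := ZMod 5)
  have hy := euler_phi_pow_four h2
  have hfP := phiNeg_mul_cardSeries h2
  -- Modulo 5 the inverse of 8 is 2, and below `24 = -1`.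
  have hw : euler (ZMod 5) (eulerLog (phiNeg (ZMod 5))) = 2 * eulerLog (phiNeg (ZMod 5)) ^ 2 -
      2 * (phi (ZMod 5) ^ 4 * (phi (ZMod 5) ^ 4 - phiNeg (ZMod 5) ^ 4)) := by
    linear_combination 2 * eight_mul_euler_eulerLog_phiNeg h2 + (6 *
      eulerLog (phiNeg (ZMod 5)) ^ 2 - 3 * euler (ZMod 5) (eulerLog (phiNeg (ZMod 5)))) * h5
  have hov : ovSeries (ZMod 5) = cardSeries (ZMod 5) -
      cardSeries (ZMod 5) * (2 * phi (ZMod 5) ^ 4 - phiNeg (ZMod 5) ^ 4) := by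
    rw [ovSeries_eq]
    linear_combination -cardSeries (ZMod 5) * one_add_lambert_eq h2 + 5 * cardSeries (ZMod 5) *
      (lambert (ZMod 5) - 2 * expandTwo (ZMod 5) (lambert (ZMod 5))) * h5
  have hθ : euler (ZMod 5) (euler (ZMod 5) (euler (ZMod 5) (phiNeg (ZMod 5)))) =
      euler (ZMod 5) (phiNeg (ZMod 5)) :=
    iterate_euler_thetaSeries _ 3 fun a => by generalize (a : ZMod 5) = b; revert b; decide
  rw [hov]
  generalize cardSeries (ZMod 5) = P at *
  generalize eulerLog (phiNeg (ZMod 5)) = w at *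
  generalize phi (ZMod 5) ^ 4 = y at *
  generalize phiNeg (ZMod 5) ^ 4 = z at *
  generalize phiNeg (ZMod 5) = f at *
  simp only [euler_mul, euler_sq, euler_two, euler_four, mul_zero, add_zero, map_add,
      map_sub, map_neg, hP, hf, hz, hy, hw] at hθ ⊢
  -- This is `D^3 φ₋ = D φ₋` divided by `φ₋`; modulo 5 it reads `w = y^3 + y^2 z - 2 y z^2`.
  -- Multiples of 5 are kept so that the identity is exact.
  have hb : 15 * w ^ 3 - 30 * w * y ^ 2 + 30 * w * y * z - 4 * y ^ 3 + 6 * y ^ 2 * z -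
      2 * y * z ^ 2 = w := by
    linear_combination P * hθ - (15 * w ^ 3 - 30 * w * y ^ 2 + 30 * w * y * z - 4 * y ^ 3 +
      6 * y ^ 2 * z - 2 * y * z ^ 2 - w) * hfP
  linear_combination -2 * P * hb - P * (6 * w ^ 2 * y - 3 * w ^ 2 * z + 16 * w * y ^ 2 -
    16 * w * y * z - 6 * w ^ 3) * h5

theorem nov_ov_modEq_five (n : ℕ) : ((n : ℤ) + 2) * (nov n : ℤ) ≡
    ((n : ℤ) ^ 2 + 4 * (n : ℤ) + 3) * (ov n : ℤ) [ZMOD 5] := by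
  have h := congrArg (coeff n) euler_sq_ovSeries_five
  rw [← map_ofNat (C (R := ZMod 5)), map_add, coeff_C_mul] at h
  simp only [coeff_euler, coeff_ovSeries, coeff_cardSeries] at h
  refine (ZMod.intCast_eq_intCast_iff _ _ 5).mp ?_
  push_cast
  rw [natCast_nov]
  have h5 : (5 : ZMod 5) = 0 := by decide
  linear_combination -h - ((n : ZMod 5) + 1) * (ov n : ZMod 5) * h5

end ModFive

/-! ### The congruence modulo 7 -/

section ModSeven

local instance : Fact (Nat.Prime 7) := ⟨by norm_num⟩

lemma two_ne_zero_zmod_seven : (2 : ZMod 7) ≠ 0 := by decide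

lemma seven_eq_zero : (7 : (ZMod 7)⟦X⟧) = 0 := by
  rw [← map_ofNat (C (R := ZMod 7)), show (OfNat.ofNat 7 : ZMod 7) = 0 from by decide, map_zero]

/-- With `c` the number of overpartitions, eliminating `nov` leaves `4 n^3 ov n = (n^3 + n) c`. -/
theorem euler_cube_ovSeries_seven :
    4 * euler (ZMod 7) (euler (ZMod 7) (euler (ZMod 7) (ovSeries (ZMod 7)))) =
      euler (ZMod 7) (euler (ZMod 7) (euler (ZMod 7) (cardSeries (ZMod 7)))) +
        euler (ZMod 7) (cardSeries (ZMod 7)) := by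
  have h2 := two_ne_zero_zmod_seven
  have h7 := seven_eq_zero
  have hP := euler_cardSeries h2
  have hf := euler_phiNeg (K := ZMod 7)
  have hz := euler_phiNeg_pow_four (K := ZMod 7)
  have hy := euler_phi_pow_four h2
  have hfP := phiNeg_mul_cardSeries h2
  have hw : euler (ZMod 7) (eulerLog (phiNeg (ZMod 7))) = 2 * eulerLog (phiNeg (ZMod 7)) ^ 2 -
      phi (ZMod 7) ^ 4 * (phi (ZMod 7) ^ 4 - phiNeg (ZMod 7) ^ 4) := by
    linear_combination eight_mul_euler_eulerLog_phiNeg h2 + (2 *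
      eulerLog (phiNeg (ZMod 7)) ^ 2 - euler (ZMod 7) (eulerLog (phiNeg (ZMod 7)))) * h7
  -- Modulo 7, `24 = 3` has inverse 5.
  have hov : ovSeries (ZMod 7) = 5 * (cardSeries (ZMod 7) *
      (2 * phi (ZMod 7) ^ 4 - phiNeg (ZMod 7) ^ 4)) - 5 * cardSeries (ZMod 7) := by
    rw [ovSeries_eq]
    linear_combination 5 * cardSeries (ZMod 7) * one_add_lambert_eq h2 -
      17 * cardSeries (ZMod 7) *
      (lambert (ZMod 7) - 2 * expandTwo (ZMod 7) (lambert (ZMod 7))) * h7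
  have hθ : euler (ZMod 7) (euler (ZMod 7) (euler (ZMod 7) (euler (ZMod 7)
      (phiNeg (ZMod 7))))) = euler (ZMod 7) (phiNeg (ZMod 7)) :=
    iterate_euler_thetaSeries _ 4 fun a => by generalize (a : ZMod 7) = b; revert b; decide
  rw [hov]
  generalize cardSeries (ZMod 7) = P at *
  generalize eulerLog (phiNeg (ZMod 7)) = w at *
  generalize phi (ZMod 7) ^ 4 = y at *
  generalize phiNeg (ZMod 7) ^ 4 = z at *
  generalize phiNeg (ZMod 7) = f at *
  -- The quotient of `D^4 φ₋ = D φ₋` by `φ₋`; modulo 7 all terms mixing `w` with `y, z` drop out, so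
  -- `w` becomes a polynomial in `y` and `z`.
  have hb : 105 * w ^ 4 - 210 * w ^ 2 * y ^ 2 + 210 * w ^ 2 * y * z + 9 * y ^ 4 -
      18 * y ^ 3 * z + 8 * y ^ 2 * z ^ 2 - 56 * w * y ^ 3 + 84 * w * y ^ 2 * z -
      28 * w * y * z ^ 2 + y * z ^ 3 = w := by
    simp only [euler_mul, euler_sq, euler_two, euler_four, mul_zero, add_zero, map_add,
      map_sub, hf, hz, hy, hw] at hθ
    linear_combination P * hθ - (105 * w ^ 4 - 210 * w ^ 2 * y ^ 2 + 210 * w ^ 2 * y * z +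
      9 * y ^ 4 - 18 * y ^ 3 * z + 8 * y ^ 2 * z ^ 2 - 56 * w * y ^ 3 + 84 * w * y ^ 2 * z -
      28 * w * y * z ^ 2 + y * z ^ 3 - w) * hfP
  have he : euler (ZMod 7) (euler (ZMod 7) (euler (ZMod 7) (P * (2 * y - z)))) =
      -euler (ZMod 7) P := by
    simp only [euler_mul, euler_sq, euler_two, euler_four, mul_zero, add_zero, map_add,
      map_sub, map_neg, hP, hz, hy, hw]
    linear_combination P * hb + P * (30 * w ^ 3 * y + 2 * w * y ^ 3 - 3 * w * y ^ 2 * z -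
      15 * w ^ 3 * z + w * y * z ^ 2 + 60 * w ^ 2 * y ^ 2 - 5 * y ^ 4 + 10 * y ^ 3 * z -
      60 * w ^ 2 * y * z - 5 * y ^ 2 * z ^ 2 - 15 * w ^ 4) * h7
  have h5 (a : (ZMod 7)⟦X⟧) : euler (ZMod 7) (5 * a) = 5 * euler (ZMod 7) a := by
    rw [euler_mul, euler_five, mul_zero, add_zero]
  simp only [map_sub, h5, he]
  linear_combination -3 * (euler (ZMod 7) P + euler (ZMod 7) (euler (ZMod 7)
    (euler (ZMod 7) P))) * h7

theorem nov_ov_modEq_seven (n : ℕ) : ((n : ℤ) ^ 2 + 1) * (nov n : ℤ) ≡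
    (4 * (n : ℤ) ^ 3 - (n : ℤ) ^ 2 - 1) * (ov n : ℤ) [ZMOD 7] := by
  have h := congrArg (coeff n) euler_cube_ovSeries_seven
  rw [← map_ofNat (C (R := ZMod 7)), map_add, coeff_C_mul] at h
  simp only [coeff_euler, coeff_ovSeries, coeff_cardSeries] at h
  refine (ZMod.intCast_eq_intCast_iff _ _ 7).mp ?_
  push_cast
  rw [natCast_nov]
  linear_combination -h

end ModSeven

theorem theorem1p2 :
    (∀ n : ℕ, ((n : ℤ) + 2) * (nov n : ℤ) ≡
      ((n : ℤ) ^ 2 + 4 * (n : ℤ) + 3) * (ov n : ℤ) [ZMOD 5]) ∧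
    (∀ n : ℕ, ((n : ℤ) ^ 2 + 1) * (nov n : ℤ) ≡
      (4 * (n : ℤ) ^ 3 - (n : ℤ) ^ 2 - 1) * (ov n : ℤ) [ZMOD 7]) :=
  ⟨nov_ov_modEq_five, nov_ov_modEq_seven⟩
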